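/- Let $F$ be a field, let $d_1,\dots,d_n\ge 0$ be integers, put $N=d_1+\cdots+d_n$, and assume that the characteristic of $F$ is $0$ or greater than $N$. Let \[ B=F[x_1,\dots,x_n]/(x_1^{d_1+1},\dots,x_n^{d_n+1}), \] and let $B_i$ be the homogeneous component of $B$ of degree $i$. Then $\dim_F B=\dim_F B_0+\dim_F B_1+\cdots+\dim_F B_N$, and for a general element $l\in B$ the Weyr structure of the multiplication map $\times l:B\to B$ is this partition of $\dim_F B$ with its parts arranged in decreasing (that is, non-increasing) order. More precisely, there is a Zariski open subset $U$ of the finite-dimensional vector space $B$, containing $x_1+\cdots+x_n$ (so that $U$ is non-empty and also meets the space $B_1$ of linear forms in a non-empty open set), such that for every $l\in U$ the map $\times l$ has exactly one eigenvalue $\lambda\in F$, and the Weyr structure of $\times l$ associated with $\lambda$ is the sequence $\dim_F B_0,\dots,\dim_F B_N$ arranged in decreasing order. Here the basic Weyr matrix $W(\lambda)$ of structure $(n_1,\dots,n_r)$, where $n_1\ge\cdots\ge n_r\ge1$, is the $r\times r$ blocked matrix whose $(i,i)$ block is $\lambda I_{n_i}$, whose $(i,i+1)$ block is the $n_i\times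 n_{i+1}$ matrix consisting of an identity matrix followed by zero rows, and whose other blocks are zero. The Weyr structure of an endomorphism $T$ of a finite-dimensional vector space associated with an eigenvalue $\lambda$ is the structure of the block $W(\lambda)$ in the Weyr form $\mathrm{diag}(W(\lambda_1),\dots,W(\lambda_k))$ of $T$ (with $\lambda_1,\dots,\lambda_k$ distinct), to which the matrix of $T$ in a suitable basis is equal. -/

import Mathlib

open Module

/-! ### Weyr matrices and Weyr structures -/

/-- `L = (n₁, …, n_r)` is a partition `n₁ ≥ n₂ ≥ ⋯ ≥ n_r ≥ 1` with at least one part. -/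
def IsWeyrPartition (L : List ℕ) : Prop :=
  L ≠ [] ∧ L.Pairwise (· ≥ ·) ∧ ∀ m ∈ L, 1 ≤ m

/-- Indices of a matrix of size `n₁ + ⋯ + n_r` blocked by `L = (n₁, …, n_r)`: the pair `⟨i, a⟩`
is the `a`-th position in the `i`-th block. -/
abbrev WeyrIndex (L : List ℕ) : Type := Σ i : Fin L.length, Fin (L.get i)

/-- The basic Weyr matrix `W(lam)` of structure `L`: the diagonal blocks are `lam • 1`, the
`(i, i+1)` blocks are an identity matrix followed by zero rows, all other blocks are zero. -/
def basicWeyrMatrix {F : Type*} [Field F] (lam : F) (L : List ℕ) :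
    Matrix (WeyrIndex L) (WeyrIndex L) F :=
  Matrix.of fun p q =>
    if p = q then lam
    else if (p.1 : ℕ) + 1 = (q.1 : ℕ) ∧ (p.2 : ℕ) = (q.2 : ℕ) then 1
    else 0

/-- The Weyr matrix `diag (W(lam₁), …, W(lam_k))`, the structure of `W(lamᵢ)` being `str i`. -/
def weyrMatrix {F : Type*} [Field F] {k : ℕ} (lam : Fin k → F) (str : Fin k → List ℕ) :
    Matrix (Σ i : Fin k, WeyrIndex (str i)) (Σ i : Fin k, WeyrIndex (str i)) F :=
  Matrix.blockDiagonal' fun i => basicWeyrMatrix (lam i) (str i)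

/-- `L` is the Weyr structure of the endomorphism `T` associated with `mu`: in some basis the
matrix of `T` is a Weyr matrix `diag (W(lam₁), …, W(lam_k))` with distinct `lamᵢ`, and `L` is the
structure of the block `W(lamᵢ)` with `lamᵢ = mu`. -/
def IsWeyrStructureAt {F V : Type*} [Field F] [AddCommGroup V] [Module F V]
    (T : Module.End F V) (mu : F) (L : List ℕ) : Prop :=
  ∃ (k : ℕ) (lam : Fin k → F) (str : Fin k → List ℕ),
    Function.Injective lam ∧
    (∀ i, IsWeyrPartition (str i)) ∧
    (∃ b : Basis (Σ i : Fin k, WeyrIndex (str i)) F V,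
      LinearMap.toMatrix b b T = weyrMatrix lam str) ∧
    ∃ i, lam i = mu ∧ str i = L

/-- `T` has exactly one eigenvalue, and `L` is the Weyr structure of `T` associated with it. -/
def HasWeyrStructure {F V : Type*} [Field F] [AddCommGroup V] [Module F V]
    (T : Module.End F V) (L : List ℕ) : Prop :=
  ∃ mu : F, (∀ nu : F, T.HasEigenvalue nu ↔ nu = mu) ∧ IsWeyrStructureAt T mu L

/-! ### The Zariski topology of a vector space -/

/-- Polynomial functions on a vector space: the `F`-algebra of functions generated by the linear
functionals. -/
def polynomialFunctionsOn (F V : Type*) [Field F] [AddCommGroup V] [Module F V] :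
    Subalgebra F (V → F) :=
  Algebra.adjoin F (Set.range fun φ : Module.Dual F V => (φ : V → F))

/-- `U` is Zariski open: its complement is the common zero set of a set of polynomial functions. -/
def IsZariskiOpen (F : Type*) {V : Type*} [Field F] [AddCommGroup V] [Module F V]
    (U : Set V) : Prop :=
  ∃ S : Set (V → F), S ⊆ (polynomialFunctionsOn F V : Set (V → F)) ∧
    U = {v | ∃ f ∈ S, f v ≠ 0}

/-! ### Monomial complete intersections -/

/-- The ideal `(x₁^(d₁+1), …, xₙ^(dₙ+1))` of `F[x₁, …, xₙ]`. -/
noncomputable def monomialCIIdeal (F : Type*) [Field F] {n : ℕ} (d : Fin n → ℕ) :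
    Ideal (MvPolynomial (Fin n) F) :=
  Ideal.span (Set.range fun i : Fin n => (MvPolynomial.X i : MvPolynomial (Fin n) F) ^ (d i + 1))

/-- The monomial complete intersection ring `F[x₁, …, xₙ]/(x₁^(d₁+1), …, xₙ^(dₙ+1))`. -/
abbrev MonomialCI (F : Type*) [Field F] {n : ℕ} (d : Fin n → ℕ) : Type _ :=
  MvPolynomial (Fin n) F ⧸ monomialCIIdeal F d

/-- The class of the variable `xᵢ`. -/
noncomputable def MonomialCI.x (F : Type*) [Field F] {n : ℕ} (d : Fin n → ℕ) (i : Fin n) : MonomialCI F d :=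
  Ideal.Quotient.mk (monomialCIIdeal F d) (MvPolynomial.X i)

/-- The homogeneous component of degree `i`: the classes of the homogeneous polynomials of
degree `i`. -/
noncomputable def MonomialCI.component (F : Type*) [Field F] {n : ℕ} (d : Fin n → ℕ) (i : ℕ) :
    Submodule F (MonomialCI F d) :=
  (MvPolynomial.homogeneousSubmodule (Fin n) F i).map
    (Ideal.Quotient.mkₐ F (monomialCIIdeal F d)).toLinearMap

/-- The dimensions of the components of degree `0, 1, …, N = d₁ + ⋯ + dₙ`, arranged in decreasing
(non-increasing) order. -/
noncomputable def MonomialCI.sortedDims (F : Type*) [Field F] {n : ℕ} (d : Fin n → ℕ) : List ℕ :=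
  ((Multiset.range ((∑ i, d i) + 1)).map
    fun i => finrank F (MonomialCI.component F d i)).sort (· ≥ ·)

/-! For nilpotent `g` the Weyr structure is the sequence of increments dim ker g^(i+1) − dim ker g^i
= dim (ker g ∩ im g^i), which is non-increasing. Subtracting the constant term c from l gives m in
the maximal ideal, and ×l = ×m + c, so everything reduces to the ranks of the powers of ×m.

Write h_i = dim B_i. For every j, the elements of degree < j contribute at most their dimension to
the image of m^k, and those of degree ≥ j land in degree ≥ j + k. Hence rank m^k ≤ ∑_{i<j} h_i +
∑_{i≥j+k} h_i. If [j, j+k) is centred in [0, N] and the bound is attained, then dim ker m^k is the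
sum of h over that window. Passing from k to k+1 adds one degree at one end of the window, so the
increments are the h_i in some order. Since they are non-increasing, they are the sorted h_i;
unimodality of h is not needed.

The bound is attained at L = x₁ + ⋯ + xₙ by the strong Lefschetz property, proved with an sl₂
lowering operator D on polynomials. D preserves the ideal, and DL^(k+1)f = L^(k+1)Df +
(k+1)(N−2i−k)L^k f for f of degree i. An induction on i and k
(`mem_monomialCIIdeal_of_sum_X_pow_mul_mem`) gives injectivity of L^k on B_i when 2i + k ≤ N. The
scalars are products of integers in [1, N], hence nonzero in F. Surjectivity in high degrees follows
from the symmetry h_i = h_(N−i).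

Attaining the bound is an open condition: it holds wherever suitable minors, polynomial in l and
nonzero at L, do not vanish. -/

/-! ### Weyr form of a nilpotent endomorphism plus a scalar -/

section NilpotentWeyr

variable {F V : Type*} [Field F] [AddCommGroup V] [Module F V]

/-- A sequence of vectors chosen greedily, the `a`-th one in `D a` and outside the span of the
preceding ones whenever there is such a vector. -/
noncomputable def greedySeq (D : ℕ → Submodule F V) (a : ℕ) : V :=
  open Classical in
  if h : ∃ x ∈ D a, x ∉ Submodule.span F (Set.range fun b : Fin a => greedySeq D b) then h.choose
  else 0
termination_by a
decreasing_by all_goals exact b.2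

/-- The `a` preceding vectors span a space of dimension at most `a`, which is too small to contain
`D a`. -/
theorem greedySeq_spec [FiniteDimensional F V] (D : ℕ → Submodule F V) (a : ℕ)
    (ha : a < finrank F (D a)) :
    greedySeq D a ∈ D a ∧
      greedySeq D a ∉ Submodule.span F (Set.range fun b : Fin a => greedySeq D b) := by
  have h : ∃ x ∈ D a, x ∉ Submodule.span F (Set.range fun b : Fin a => greedySeq D b) := by
    by_contra! hcon
    have h1 : finrank F (D a) ≤
        finrank F (Submodule.span F (Set.range fun b : Fin a => greedySeq D b)) :=
      Submodule.finrank_mono hcon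
    have h2 := finrank_range_le_card (R := F) (fun b : Fin a => greedySeq D b)
    rw [Set.finrank, Fintype.card_fin] at h2
    omega
  rw [greedySeq.eq_def D a, dif_pos h]
  exact h.choose_spec

theorem greedySeq_linearIndependent [FiniteDimensional F V] (D : ℕ → Submodule F V) (k : ℕ)
    (hk : ∀ a < k, a < finrank F (D a)) :
    LinearIndependent F fun a : Fin k => greedySeq D a := by
  induction k with
  | zero => exact linearIndependent_empty_type
  | succ k ih =>
    rw [linearIndependent_finSucc']
    refine ⟨ih fun a ha => hk a (by omega), ?_⟩
    exact (greedySeq_spec D k (hk k (by omega))).2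

/-- Rank–nullity for g^k restricted to ker g^(k+1): its image is ker g ∩ im g^k and its kernel is
ker g^k. -/
theorem finrank_ker_pow_succ [FiniteDimensional F V] (g : Module.End F V) (k : ℕ) :
    finrank F (LinearMap.ker (g ^ (k + 1))) = finrank F (LinearMap.ker (g ^ k)) +
      finrank F (LinearMap.ker g ⊓ LinearMap.range (g ^ k) : Submodule F V) := by
  have h := LinearMap.finrank_range_add_finrank_ker
    ((g ^ k).domRestrict (LinearMap.ker (g ^ (k + 1))))
  have h1 : LinearMap.range ((g ^ k).domRestrict (LinearMap.ker (g ^ (k + 1)))) =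
      LinearMap.ker g ⊓ LinearMap.range (g ^ k) := by
    ext x
    constructor
    · rintro ⟨⟨y, hy⟩, rfl⟩
      refine ⟨?_, y, rfl⟩
      rw [LinearMap.mem_ker, pow_succ'] at hy
      exact hy
    · rintro ⟨hx, y, rfl⟩
      refine ⟨⟨y, ?_⟩, rfl⟩
      rw [LinearMap.mem_ker, pow_succ']
      exact hx
  have hle : LinearMap.ker (g ^ k) ≤ LinearMap.ker (g ^ (k + 1)) := by
    intro x hx
    rw [LinearMap.mem_ker, pow_succ', Module.End.mul_apply, LinearMap.mem_ker.1 hx, map_zero]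
  have h2 : finrank F (LinearMap.ker ((g ^ k).domRestrict (LinearMap.ker (g ^ (k + 1))))) =
      finrank F (LinearMap.ker (g ^ k)) := by
    rw [LinearMap.ker_domRestrict]
    exact (Submodule.comapSubtypeEquivOfLe hle).finrank_eq
  rw [h1, h2] at h
  omega

/-- Jordan chains `v i a` of a nilpotent endomorphism, chosen with the lengths of the chains in
decreasing order. -/
theorem exists_chains [FiniteDimensional F V] (g : Module.End F V) (r : ℕ) :
    ∃ v : ℕ → ℕ → V,
      (LinearIndependent F fun a : Fin (finrank F (LinearMap.ker g)) => v 0 a) ∧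
      (∀ a < finrank F (LinearMap.ker g), g (v 0 a) = 0) ∧
      ∀ i a, i + 1 < r →
        a < finrank F (LinearMap.ker g ⊓ LinearMap.range (g ^ (i + 1)) : Submodule F V) →
        g (v (i + 1) a) = v i a := by
  classical
  set D : ℕ → Submodule F V := fun i => LinearMap.ker g ⊓ LinearMap.range (g ^ i) with hD
  have hD0 : D 0 = LinearMap.ker g := by
    simp [hD, Module.End.one_eq_id, LinearMap.range_id]
  -- The spaces `D i` decrease with `i`. The height of `a` is the last `i ≤ r` at which `D i` still
  -- has room for an `a`-th independent vector; picking `w a` there makes it the end of a chain with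
  -- `ht a + 1` members.
  set ht : ℕ → ℕ := fun a => Nat.findGreatest (fun i => a < finrank F (D i)) r with hht
  set w := greedySeq fun a => D (ht a) with hw
  have hpos : ∀ a < finrank F (LinearMap.ker g), a < finrank F (D (ht a)) := by
    intro a ha
    exact Nat.findGreatest_spec (P := fun i => a < finrank F (D i)) (Nat.zero_le r)
      (by rw [hD0]; exact ha)
  have hmem : ∀ a < finrank F (LinearMap.ker g), w a ∈ D (ht a) := fun a ha =>
    (greedySeq_spec (fun a => D (ht a)) a (hpos a ha)).1
  have hu : ∀ a, ∃ u : V, a < finrank F (LinearMap.ker g) → (g ^ ht a) u = w a := by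
    intro a
    by_cases ha : a < finrank F (LinearMap.ker g)
    · obtain ⟨u, hu⟩ := (hmem a ha).2
      exact ⟨u, fun _ => hu⟩
    · exact ⟨0, fun h => absurd h ha⟩
  choose u hu using hu
  -- For `i > ht a` the truncated subtraction yields the irrelevant value `u a`; the chain relation
  -- is only required up to the height.
  refine ⟨fun i a => (g ^ (ht a - i)) (u a), ?_, ?_, ?_⟩
  · have := greedySeq_linearIndependent (fun a => D (ht a)) (finrank F (LinearMap.ker g)) hpos
    convert this using 2 with a
    simpa using hu a a.2
  · intro a ha
    simp only [Nat.sub_zero]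
    rw [hu a ha]
    exact (hmem a ha).1
  · intro i a hi ha
    have hle : i + 1 ≤ ht a :=
      Nat.le_findGreatest (P := fun i => a < finrank F (D i)) hi.le ha
    have : ht a - i = (ht a - (i + 1)) + 1 := by omega
    simp only [this, pow_succ', Module.End.mul_apply]

theorem finrank_ker_inf_range_pow_antitone [FiniteDimensional F V] (g : Module.End F V) :
    Antitone fun i =>
      finrank F (LinearMap.ker g ⊓ LinearMap.range (g ^ i) : Submodule F V) := by
  refine antitone_nat_of_succ_le fun i => Submodule.finrank_mono ?_
  refine inf_le_inf_left _ ?_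
  rintro x ⟨y, rfl⟩
  exact ⟨g y, by rw [pow_succ, Module.End.mul_apply]⟩

theorem sum_finrank_ker_inf_range_pow [FiniteDimensional F V] (g : Module.End F V) (r : ℕ) :
    ∑ i ∈ Finset.range r,
      finrank F (LinearMap.ker g ⊓ LinearMap.range (g ^ i) : Submodule F V) =
      finrank F (LinearMap.ker (g ^ r)) := by
  induction r with
  | zero => rw [Finset.sum_range_zero, pow_zero, Module.End.one_eq_id, LinearMap.ker_id, finrank_bot]
  | succ r ih => rw [Finset.sum_range_succ, ih, finrank_ker_pow_succ]

theorem exists_basis_toMatrix_eq_basicWeyrMatrix [FiniteDimensional F V] (g : Module.End F V)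
    (L : List ℕ)
    (hL : ∀ i : Fin L.length, L.get i =
      finrank F (LinearMap.ker g ⊓ LinearMap.range (g ^ (i : ℕ)) : Submodule F V))
    (hg : g ^ L.length = 0) (c : F) :
    ∃ b : Basis (WeyrIndex L) F V,
      LinearMap.toMatrix b b (g + c • 1) = basicWeyrMatrix c L := by
  classical
  obtain ⟨v, hv, hv0, hvs⟩ := exists_chains g L.length
  have anti := finrank_ker_inf_range_pow_antitone g
  have hker : ∀ i, finrank F (LinearMap.ker g ⊓ LinearMap.range (g ^ i) : Submodule F V) ≤
      finrank F (LinearMap.ker g) := fun i => Submodule.finrank_mono inf_le_left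
  have hpow : ∀ k i a, i < L.length →
      a < finrank F (LinearMap.ker g ⊓ LinearMap.range (g ^ i) : Submodule F V) →
      (g ^ k) (v i a) = if k ≤ i then v (i - k) a else 0 := by
    intro k
    induction k with
    | zero => intro i a _ _; simp
    | succ k ih =>
      intro i a hi ha
      rw [pow_succ, Module.End.mul_apply]
      rcases i with _ | i
      · rw [hv0 a (ha.trans_le (hker _))]; simp
      · rw [hvs i a hi ha, ih i a (by omega) (ha.trans_le (anti (Nat.le_succ i)))]
        simp
  let f : WeyrIndex L → V := fun p => v p.1 p.2
  have hlt : ∀ p : WeyrIndex L, (p.2 : ℕ) <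
      finrank F (LinearMap.ker g ⊓ LinearMap.range (g ^ (p.1 : ℕ)) : Submodule F V) :=
    fun p => p.2.2.trans_eq (hL p.1)
  have hli : LinearIndependent F f := by
    rw [Fintype.linearIndependent_iff]
    intro x hx
    -- Descending induction on the block. Applying `g ^ p.1` to the relation kills the earlier
    -- blocks, the later ones already have zero coefficients, and block `p.1` is carried to the
    -- independent vectors `v 0 a`.
    have key : ∀ t : ℕ, ∀ p : WeyrIndex L, L.length ≤ p.1 + t → x p = 0 := by
      intro t
      induction t with
      | zero => intro p hp; exact absurd p.1.2 (by omega)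
      | succ t ih =>
        intro p hp
        by_cases hpt : L.length ≤ p.1 + t
        · exact ih p hpt
        have h1 := congrArg (g ^ (p.1 : ℕ)) hx
        rw [map_zero, map_sum, Fintype.sum_sigma, Finset.sum_eq_single p.1] at h1
        · have h2 : ∀ a : Fin (L.get p.1), (g ^ (p.1 : ℕ)) (x ⟨p.1, a⟩ • f ⟨p.1, a⟩) =
              x ⟨p.1, a⟩ • v 0 a := by
            intro a
            rw [map_smul, hpow _ _ _ p.1.2 (hlt ⟨p.1, a⟩)]
            simp
          rw [Finset.sum_congr rfl fun a _ => h2 a] at h1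
          have h3 : LinearIndependent F fun a : Fin (L.get p.1) => v 0 a :=
            hv.comp (Fin.castLE ((hL p.1).le.trans (hker _))) (Fin.castLE_injective _)
          exact Fintype.linearIndependent_iff.1 h3 _ h1 p.2
        · intro i _ hi
          refine Finset.sum_eq_zero fun a _ => ?_
          rcases lt_or_gt_of_ne hi with h | h
          · rw [map_smul, hpow _ _ _ i.2 (hlt ⟨i, a⟩), if_neg (by simpa using h), smul_zero]
          · rw [ih ⟨i, a⟩ (by simp only; have : (p.1 : ℕ) < i := h; omega), zero_smul, map_zero]
        · simp
    exact fun p => key L.length p (by omega)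
  have hcard : Fintype.card (WeyrIndex L) = finrank F V := by
    rw [Fintype.card_sigma]
    simp only [Fintype.card_fin]
    rw [Finset.sum_congr rfl fun i _ => hL i,
      Fin.sum_univ_eq_sum_range
        (fun i => finrank F (LinearMap.ker g ⊓ LinearMap.range (g ^ i) : Submodule F V)),
      sum_finrank_ker_inf_range_pow, hg, LinearMap.ker_zero, finrank_top]
  have hmat : ∃ b : Basis (WeyrIndex L) F V, ⇑b = f := by
    rcases isEmpty_or_nonempty (WeyrIndex L) with hE | hN
    · have : Subsingleton V := by
        rw [← finrank_zero_iff (R := F), ← hcard, Fintype.card_eq_zero]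
      exact ⟨Basis.empty V, funext fun p => isEmptyElim p⟩
    · exact ⟨basisOfLinearIndependentOfCardEqFinrank hli hcard, by simp⟩
  obtain ⟨b, hb⟩ := hmat
  refine ⟨b, ?_⟩
  ext p q
  rw [LinearMap.toMatrix_apply, basicWeyrMatrix, Matrix.of_apply, LinearMap.add_apply,
    LinearMap.smul_apply, Module.End.one_apply, map_add, map_smul, Finsupp.add_apply,
    Finsupp.smul_apply, Basis.repr_self, Finsupp.single_apply]
  have h1 : b.repr (g (b q)) p =
      if (p.1 : ℕ) + 1 = (q.1 : ℕ) ∧ (p.2 : ℕ) = (q.2 : ℕ) then 1 else 0 := by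
    obtain ⟨⟨i, hi⟩, a⟩ := q
    rcases i with _ | i
    · have : g (b ⟨⟨0, hi⟩, a⟩) = 0 := by
        rw [hb]; exact hv0 a ((hlt ⟨⟨0, hi⟩, a⟩).trans_le (hker _))
      rw [this]
      simp
    · have hq := hlt ⟨⟨i + 1, hi⟩, a⟩
      have ha : (a : ℕ) < L.get ⟨i, by omega⟩ :=
        (hq.trans_le (anti (Nat.le_succ i))).trans_eq (hL ⟨i, by omega⟩).symm
      have : g (b ⟨⟨i + 1, hi⟩, a⟩) = b ⟨⟨i, by omega⟩, ⟨a, ha⟩⟩ := by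
        rw [hb]; exact hvs i a hi hq
      rw [this, Basis.repr_self, Finsupp.single_apply]
      refine if_congr ?_ rfl rfl
      obtain ⟨⟨j, hj⟩, a'⟩ := p
      constructor
      · intro h
        cases h
        exact ⟨rfl, rfl⟩
      · rintro ⟨h, h'⟩
        simp only [Nat.add_right_cancel_iff] at h
        subst h
        simp only at h'
        congr 1
        exact Fin.ext h'.symm
  rw [h1]
  by_cases hpq : p = q
  · subst hpq; simp
  · rw [if_neg (Ne.symm hpq), if_neg hpq]; simp

theorem hasEigenvalue_add_smul_iff_of_isNilpotent [Nontrivial V] (g : Module.End F V)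
    (hg : IsNilpotent g) (c nu : F) :
    (g + c • 1 : Module.End F V).HasEigenvalue nu ↔ nu = c := by
  constructor
  · intro h
    obtain ⟨x, hx⟩ := h.exists_hasEigenvector
    have h1 : g x = (nu - c) • x := by
      have := hx.apply_eq_smul
      rw [LinearMap.add_apply, LinearMap.smul_apply, Module.End.one_apply] at this
      rw [sub_smul, ← this]; abel
    obtain ⟨k, hk⟩ := hg
    have h2 : ∀ j : ℕ, (g ^ j) x = (nu - c) ^ j • x := by
      intro j
      induction j with
      | zero => simp
      | succ j ih => rw [pow_succ', Module.End.mul_apply, ih, map_smul, h1, smul_smul, pow_succ]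
    have h3 := h2 k
    rw [hk, LinearMap.zero_apply, eq_comm, smul_eq_zero] at h3
    exact sub_eq_zero.1 (eq_zero_of_pow_eq_zero (h3.resolve_right hx.2))
  · rintro rfl
    have hnb : LinearMap.ker g ≠ ⊥ := by
      intro hbot
      obtain ⟨k, hk⟩ := hg
      have hinj : Function.Injective (g ^ k) := by
        rw [Module.End.coe_pow]
        exact (LinearMap.ker_eq_bot.1 hbot).iterate k
      obtain ⟨x, hx⟩ := exists_ne (0 : V)
      exact hx (hinj (by rw [hk]; simp))
    obtain ⟨x, hx, hx0⟩ := Submodule.exists_mem_ne_zero_of_ne_bot hnb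
    refine Module.End.hasEigenvalue_of_hasEigenvector (x := x) ⟨?_, hx0⟩
    rw [Module.End.mem_eigenspace_iff]
    simp [LinearMap.mem_ker.1 hx]

theorem hasWeyrStructure_add_smul [FiniteDimensional F V] [Nontrivial V] (g : Module.End F V)
    (L : List ℕ)
    (hL : ∀ i : Fin L.length, L.get i =
      finrank F (LinearMap.ker g ⊓ LinearMap.range (g ^ (i : ℕ)) : Submodule F V))
    (hg : g ^ L.length = 0) (hpart : IsWeyrPartition L) (c : F) :
    HasWeyrStructure (g + c • 1 : Module.End F V) L := by
  refine ⟨c, fun nu => hasEigenvalue_add_smul_iff_of_isNilpotent g ⟨_, hg⟩ c nu, ?_⟩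
  obtain ⟨b, hb⟩ := exists_basis_toMatrix_eq_basicWeyrMatrix g L hL hg c
  refine ⟨1, fun _ => c, fun _ => L, fun _ _ _ => Subsingleton.elim _ _, fun _ => hpart, ?_,
    0, rfl, rfl⟩
  refine ⟨b.reindex (Equiv.uniqueSigma fun _ : Fin 1 => WeyrIndex L).symm, ?_⟩
  ext ⟨i, p⟩ ⟨j, q⟩
  obtain rfl := Subsingleton.elim i j
  rw [weyrMatrix, Matrix.blockDiagonal'_apply_eq, ← hb, LinearMap.toMatrix_apply,
    LinearMap.toMatrix_apply]
  rw [Basis.repr_reindex_apply, Basis.reindex_apply]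
  obtain rfl := Subsingleton.elim 0 i
  rfl

end NilpotentWeyr

/-! ### The sl₂ lowering operator and the strong Lefschetz property -/

section Lowering

open MvPolynomial

variable {F : Type*} [Field F] {n : ℕ}

/-- The operator `∑ i, (dᵢ ∂ᵢ - xᵢ ∂ᵢ²)`, the lowering operator of the action of `sl₂` for which
multiplication by `x₁ + ⋯ + xₙ` is the raising operator. -/
noncomputable def loweringOp (d : Fin n → ℕ) (f : MvPolynomial (Fin n) F) :
    MvPolynomial (Fin n) F :=
  ∑ i, ((d i : MvPolynomial (Fin n) F) * pderiv i f - X i * pderiv i (pderiv i f))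

theorem loweringOp_add (d : Fin n → ℕ) (f g : MvPolynomial (Fin n) F) :
    loweringOp d (f + g) = loweringOp d f + loweringOp d g := by
  simp only [loweringOp, map_add, ← Finset.sum_add_distrib]
  refine Finset.sum_congr rfl fun i _ => ?_
  ring

theorem loweringOp_zero (d : Fin n → ℕ) :
    loweringOp d (0 : MvPolynomial (Fin n) F) = 0 := by
  simp [loweringOp]

theorem loweringOp_X_mul (d : Fin n → ℕ) (j : Fin n) (f : MvPolynomial (Fin n) F) :
    loweringOp d (X j * f) =
      X j * loweringOp d f + (d j : MvPolynomial (Fin n) F) * f - 2 * (X j * pderiv j f) := by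
  have h : ∀ i, (d i : MvPolynomial (Fin n) F) * pderiv i (X j * f) -
      X i * pderiv i (pderiv i (X j * f)) =
      X j * ((d i : MvPolynomial (Fin n) F) * pderiv i f - X i * pderiv i (pderiv i f)) +
        if i = j then (d i : MvPolynomial (Fin n) F) * f - 2 * (X i * pderiv i f) else 0 := by
    intro i
    by_cases hij : i = j
    · subst hij
      simp only [Derivation.leibniz, map_add, smul_eq_mul, pderiv_X_self, pderiv_one, if_true]
      ring
    · simp only [Derivation.leibniz, map_add, smul_eq_mul, pderiv_X_of_ne (Ne.symm hij), if_neg hij,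
        map_zero]
      ring
  simp only [loweringOp, h, Finset.sum_add_distrib, Finset.sum_ite_eq', Finset.mem_univ, if_true,
    ← Finset.mul_sum]
  ring

/-- The sl₂ commutator relation: by Euler's identity ∑ xⱼ∂ⱼ acts on degree `i` as the scalar `i`, so
the commutator acts as N − 2i. -/
theorem loweringOp_sum_X_mul (d : Fin n → ℕ) {f : MvPolynomial (Fin n) F} {i : ℕ}
    (hf : f.IsHomogeneous i) :
    loweringOp d ((∑ j, X j) * f) =
      (∑ j, X j) * loweringOp d f + C ((∑ j, d j : ℕ) - 2 * (i : F)) * f := by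
  have h0 : ∀ s : Finset (Fin n), loweringOp d ((∑ j ∈ s, X j) * f) =
      ∑ j ∈ s, loweringOp d (X j * f) := by
    intro s
    induction s using Finset.induction_on with
    | empty => simp [loweringOp_zero]
    | insert a s ha ih => rw [Finset.sum_insert ha, Finset.sum_insert ha, add_mul, loweringOp_add, ih]
  have h1 := hf.sum_X_mul_pderiv
  rw [h0]
  simp only [loweringOp_X_mul, Finset.sum_sub_distrib, Finset.sum_add_distrib, ← Finset.sum_mul,
    ← Finset.mul_sum, h1]
  simp only [map_sub, map_mul, map_natCast, map_ofNat, nsmul_eq_mul, Nat.cast_sum, map_sum]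
  ring

theorem isHomogeneous_sum_X_pow_mul {f : MvPolynomial (Fin n) F} {i : ℕ} (hf : f.IsHomogeneous i)
    (k : ℕ) : ((∑ j, X j) ^ k * f).IsHomogeneous (i + k) := by
  have h1 : (∑ j, X j : MvPolynomial (Fin n) F).IsHomogeneous 1 :=
    IsHomogeneous.sum _ _ _ fun j _ => isHomogeneous_X _ _
  have := (h1.pow k).mul hf
  rwa [one_mul, add_comm] at this

theorem loweringOp_sum_X_pow_mul (d : Fin n → ℕ) {f : MvPolynomial (Fin n) F} {i : ℕ}
    (hf : f.IsHomogeneous i) (k : ℕ) :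
    loweringOp d ((∑ j, X j) ^ (k + 1) * f) =
      (∑ j, X j) ^ (k + 1) * loweringOp d f +
        C (((k + 1 : ℕ) : F) * ((∑ j, d j : ℕ) - 2 * (i : F) - k)) * ((∑ j, X j) ^ k * f) := by
  induction k with
  | zero =>
    rw [zero_add, pow_one, loweringOp_sum_X_mul d hf]
    simp
  | succ k ih =>
    rw [pow_succ', mul_assoc, loweringOp_sum_X_mul d (isHomogeneous_sum_X_pow_mul hf (k + 1)), ih]
    simp only [map_sub, map_mul, map_natCast, map_ofNat, Nat.cast_add, Nat.cast_one, map_one,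
      map_add]
    ring

/-- The coefficient dⱼ in the operator is chosen for this: the only terms of xⱼ-order below dⱼ + 1
are dⱼ(dⱼ+1)xⱼ^dⱼ f from the first derivative and its negative from the second, and they cancel. -/
theorem loweringOp_mul_X_pow_mem (d : Fin n → ℕ) (j : Fin n) (f : MvPolynomial (Fin n) F) :
    loweringOp d (f * X j ^ (d j + 1)) ∈ monomialCIIdeal F d := by
  have hgen : (X j : MvPolynomial (Fin n) F) ^ (d j + 1) ∈ monomialCIIdeal F d :=
    Ideal.subset_span ⟨j, rfl⟩
  refine Ideal.sum_mem _ fun i _ => ?_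
  by_cases hij : i = j
  · subst hij
    have h1 : ∀ g : MvPolynomial (Fin n) F, pderiv i (g * X i ^ (d i + 1)) =
        pderiv i g * X i ^ (d i + 1) + (d i + 1 : MvPolynomial (Fin n) F) * (g * X i ^ d i) := by
      intro g
      rw [Derivation.leibniz, Derivation.leibniz_pow, pderiv_X_self]
      simp only [smul_eq_mul, nsmul_eq_mul, Nat.add_sub_cancel, Nat.cast_add, Nat.cast_one]
      ring
    have h2 : X i * pderiv i (f * X i ^ d i) =
        pderiv i f * X i ^ (d i + 1) + (d i : MvPolynomial (Fin n) F) * (f * X i ^ d i) := by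
      rw [Derivation.leibniz, Derivation.leibniz_pow, pderiv_X_self]
      -- The derivative of `X i ^ d i` has the truncated exponent `d i - 1`, so exponent zero is
      -- treated apart.
      rcases d i with _ | e
      · simp [mul_comm]
      · simp only [smul_eq_mul, nsmul_eq_mul, Nat.add_sub_cancel]
        ring
    have h3 : pderiv i ((d i + 1 : MvPolynomial (Fin n) F) * (f * X i ^ d i)) =
        (d i + 1 : MvPolynomial (Fin n) F) * pderiv i (f * X i ^ d i) := by
      rw [Derivation.leibniz]
      simp
    have : (d i : MvPolynomial (Fin n) F) * pderiv i (f * X i ^ (d i + 1)) -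
        X i * pderiv i (pderiv i (f * X i ^ (d i + 1))) =
        ((d i : MvPolynomial (Fin n) F) * pderiv i f - X i * pderiv i (pderiv i f)
          - 2 * (d i + 1 : MvPolynomial (Fin n) F) * pderiv i f) * X i ^ (d i + 1) := by
      rw [h1, map_add, h1, h3]
      linear_combination (-(d i + 1 : MvPolynomial (Fin n) F)) * h2
    rw [this]
    exact Ideal.mul_mem_left _ _ hgen
  · have h1 : ∀ g : MvPolynomial (Fin n) F,
        pderiv i (g * X j ^ (d j + 1)) = pderiv i g * X j ^ (d j + 1) := by
      intro g
      rw [Derivation.leibniz, Derivation.leibniz_pow, pderiv_X_of_ne (Ne.symm hij)]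
      simp [mul_comm]
    rw [h1, h1, ← mul_assoc, ← mul_assoc, ← sub_mul]
    exact Ideal.mul_mem_left _ _ hgen

theorem loweringOp_mem (d : Fin n → ℕ) {f : MvPolynomial (Fin n) F}
    (hf : f ∈ monomialCIIdeal F d) : loweringOp d f ∈ monomialCIIdeal F d := by
  obtain ⟨c, rfl⟩ := (Ideal.mem_span_range_iff_exists_fun).1 hf
  have h0 : ∀ s : Finset (Fin n), loweringOp d (∑ j ∈ s, c j * X j ^ (d j + 1)) =
      ∑ j ∈ s, loweringOp d (c j * X j ^ (d j + 1)) := by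
    intro s
    induction s using Finset.induction_on with
    | empty => simp [loweringOp_zero]
    | insert a s ha ih => rw [Finset.sum_insert ha, Finset.sum_insert ha, loweringOp_add, ih]
  rw [h0]
  exact Ideal.sum_mem _ fun j _ => loweringOp_mul_X_pow_mem d j _

theorem isHomogeneous_loweringOp (d : Fin n → ℕ) {f : MvPolynomial (Fin n) F} {i : ℕ}
    (hf : f.IsHomogeneous (i + 1)) : (loweringOp d f).IsHomogeneous i := by
  refine IsHomogeneous.sum _ _ _ fun j _ => ?_
  have h1 : (pderiv j f).IsHomogeneous i := hf.pderiv
  refine IsHomogeneous.sub ?_ ?_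
  · have := h1.C_mul (d j : F)
    rwa [map_natCast] at this
  · rcases i with _ | i
    · have : pderiv j (pderiv j f) = 0 := by
        rw [totalDegree_eq_zero_iff_eq_C.1 ((totalDegree_zero_iff_isHomogeneous _).2 h1), pderiv_C]
      rw [this, mul_zero]
      exact isHomogeneous_zero _ _ _
    · have h2 : (pderiv j (pderiv j f)).IsHomogeneous i := h1.pderiv
      have := (isHomogeneous_X F j).mul h2
      rwa [add_comm] at this

theorem loweringOp_eq_zero_of_isHomogeneous_zero (d : Fin n → ℕ) {f : MvPolynomial (Fin n) F}
    (hf : f.IsHomogeneous 0) : loweringOp d f = 0 := by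
  rw [totalDegree_eq_zero_iff_eq_C.1 ((totalDegree_zero_iff_isHomogeneous _).2 hf)]
  simp [loweringOp]

theorem natCast_ne_zero_of_le (p : ℕ) [CharP F p] {N m : ℕ} (hp : p = 0 ∨ N < p) (hm : 0 < m)
    (hmN : m ≤ N) : (m : F) ≠ 0 := by
  rw [Ne, CharP.cast_eq_zero_iff F p]
  intro hdvd
  rcases hp with rfl | hp
  · rw [zero_dvd_iff] at hdvd; omega
  · have := Nat.le_of_dvd hm hdvd; omega

/-- The strong Lefschetz property of the monomial complete intersection, injectivity half. -/
theorem mem_monomialCIIdeal_of_sum_X_pow_mul_mem (p : ℕ) [CharP F p] (d : Fin n → ℕ)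
    (hp : p = 0 ∨ ∑ i, d i < p) (i : ℕ) :
    ∀ (k : ℕ) (f : MvPolynomial (Fin n) F), f.IsHomogeneous i → 2 * i + k ≤ ∑ j, d j →
      (∑ j, X j) ^ k * f ∈ monomialCIIdeal F d → f ∈ monomialCIIdeal F d := by
  induction i with
  | zero =>
    intro k
    induction k with
    | zero => intro f _ _ h; simpa using h
    | succ k ih =>
      intro f hf hk h
      refine ih f hf (by omega) ?_
      have h1 := loweringOp_mem d h
      rw [loweringOp_sum_X_pow_mul d hf, loweringOp_eq_zero_of_isHomogeneous_zero d hf, mul_zero,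
        zero_add] at h1
      -- Both factors, k + 1 and N − k, are integers in [1, N] because k + 1 ≤ N.
      have hc : ((k + 1 : ℕ) : F) * ((∑ j, d j : ℕ) - 2 * ((0 : ℕ) : F) - k) ≠ 0 := by
        refine mul_ne_zero (natCast_ne_zero_of_le p hp (by omega) (by omega)) ?_
        have : ((∑ j, d j : ℕ) : F) - 2 * ((0 : ℕ) : F) - k = ((∑ j, d j - k : ℕ) : F) := by
          rw [Nat.cast_sub (by omega)]; simp
        rw [this]
        exact natCast_ne_zero_of_le p hp (by omega) (by omega)
      have h2 := Ideal.mul_mem_left _ (C (((k + 1 : ℕ) : F) * ((∑ j, d j : ℕ) - 2 * ((0 : ℕ) : F) - k))⁻¹) h1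
      rwa [← mul_assoc, ← C_mul, inv_mul_cancel₀ hc, C_1, one_mul] at h2
  | succ i IH =>
    intro k
    induction k with
    | zero => intro f _ _ h; simpa using h
    | succ k ih =>
      intro f hf hk h
      refine ih f hf (by omega) ?_
      have h1 := loweringOp_mem d h
      rw [loweringOp_sum_X_pow_mul d hf] at h1
      -- Multiplying the relation by L turns its last term into a multiple of L^(k+1) f, which lies
      -- in the ideal. What is left is L^(k+2) Df, and Df has degree one less, so 2·deg + exponent
      -- stays within N.
      have hD : loweringOp d f ∈ monomialCIIdeal F d := by
        refine IH (k + 2) _ (isHomogeneous_loweringOp d hf) (by omega) ?_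
        have h3 := Ideal.mul_mem_left _ (∑ j, X j) h1
        rw [mul_add] at h3
        have h4 : (∑ j, X j) * (C (((k + 1 : ℕ) : F) *
            ((∑ j, d j : ℕ) - 2 * ((i + 1 : ℕ) : F) - k)) * ((∑ j, X j) ^ k * f)) ∈
            monomialCIIdeal F d := by
          have := Ideal.mul_mem_left _ (C (((k + 1 : ℕ) : F) *
            ((∑ j, d j : ℕ) - 2 * ((i + 1 : ℕ) : F) - k))) h
          convert this using 1
          ring
        have h5 := (Ideal.add_mem_iff_left _ h4).1 h3
        convert h5 using 1
        ring
      have h1 := (Ideal.add_mem_iff_right _ (Ideal.mul_mem_left _ _ hD)).1 h1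
      have hc : ((k + 1 : ℕ) : F) * ((∑ j, d j : ℕ) - 2 * ((i + 1 : ℕ) : F) - k) ≠ 0 := by
        refine mul_ne_zero (natCast_ne_zero_of_le p hp (by omega) (by omega)) ?_
        have : ((∑ j, d j : ℕ) : F) - 2 * ((i + 1 : ℕ) : F) - k =
            ((∑ j, d j - (2 * (i + 1) + k) : ℕ) : F) := by
          rw [Nat.cast_sub (by omega)]; push_cast; ring
        rw [this]
        exact natCast_ne_zero_of_le p hp (by omega) (by omega)
      have h2 := Ideal.mul_mem_left _ (C (((k + 1 : ℕ) : F) * ((∑ j, d j : ℕ) - 2 * ((i + 1 : ℕ) : F) - k))⁻¹) h1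
      rwa [← mul_assoc, ← C_mul, inv_mul_cancel₀ hc, C_1, one_mul] at h2

end Lowering

/-! ### Monomial basis, grading and Hilbert function -/

section MonomialBasis

open MvPolynomial

/-- The exponents of the monomials which form a basis of a monomial complete intersection. -/
abbrev CIExponent {n : ℕ} (d : Fin n → ℕ) : Type := (i : Fin n) → Fin (d i + 1)

/-- An exponent as a finitely supported function. -/
noncomputable def CIExponent.toFinsupp {n : ℕ} {d : Fin n → ℕ} (s : CIExponent d) : Fin n →₀ ℕ :=
  Finsupp.equivFunOnFinite.symm fun i => (s i : ℕ)

/-- The degree of a monomial. -/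
def CIExponent.deg {n : ℕ} {d : Fin n → ℕ} (s : CIExponent d) : ℕ := ∑ i, (s i : ℕ)

/-- The number of basis monomials whose degree belongs to `T`. -/
noncomputable def degCount {n : ℕ} (d : Fin n → ℕ) (T : Set ℕ) : ℕ :=
  {s : CIExponent d | s.deg ∈ T}.ncard

section Count

variable {n : ℕ} (d : Fin n → ℕ)

theorem CIExponent.deg_le (s : CIExponent d) : s.deg ≤ ∑ i, d i :=
  Finset.sum_le_sum fun i _ => Nat.lt_succ_iff.1 (s i).2

theorem CIExponent.degree_toFinsupp (s : CIExponent d) : s.toFinsupp.degree = s.deg := by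
  rw [Finsupp.degree_eq_sum]
  rfl

theorem CIExponent.toFinsupp_injective :
    Function.Injective (CIExponent.toFinsupp : CIExponent d → Fin n →₀ ℕ) := by
  intro s t h
  funext i
  exact Fin.ext (DFunLike.congr_fun h i)

theorem degCount_union {T T' : Set ℕ} (h : Disjoint T T') :
    degCount d (T ∪ T') = degCount d T + degCount d T' := by
  unfold degCount
  rw [← Set.ncard_union_eq _ (Set.toFinite _) (Set.toFinite _)]
  · rfl
  · exact Set.disjoint_left.2 fun s hs hs' => Set.disjoint_left.1 h hs hs'

theorem degCount_finset (T : Finset ℕ) :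
    degCount d (T : Set ℕ) = ∑ i ∈ T, degCount d {i} := by
  induction T using Finset.induction_on with
  | empty => simp [degCount]
  | insert a T ha ih =>
    rw [Finset.sum_insert ha, Finset.coe_insert, Set.insert_eq, degCount_union, ih]
    simpa using ha

theorem degCount_congr {T T' : Set ℕ} (h : ∀ i ≤ ∑ j, d j, i ∈ T ↔ i ∈ T') :
    degCount d T = degCount d T' := by
  unfold degCount
  congr 1
  ext s
  exact h _ s.deg_le

/-- The involution s ↦ d − s on exponents exchanges degrees i and N − i. -/
theorem degCount_reverse {i : ℕ} (hi : i ≤ ∑ j, d j) :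
    degCount d {∑ j, d j - i} = degCount d {i} := by
  have key : ∀ s : CIExponent d, CIExponent.deg (fun j => (s j).rev) + s.deg = ∑ j, d j := by
    intro s
    rw [CIExponent.deg, CIExponent.deg, ← Finset.sum_add_distrib]
    refine Finset.sum_congr rfl fun j _ => ?_
    have := (s j).2
    rw [Fin.val_rev]
    omega
  have hinj : Function.Injective fun (s : CIExponent d) (j : Fin n) => (s j).rev := by
    intro s t h
    funext j
    exact Fin.rev_injective (congrFun h j)
  unfold degCount
  rw [← Set.ncard_image_of_injective {s : CIExponent d | s.deg ∈ ({i} : Set ℕ)} hinj]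
  congr 1
  ext s
  simp only [Set.mem_ofPred_eq, Set.mem_singleton_iff, Set.mem_image]
  constructor
  · intro hs
    refine ⟨fun j => (s j).rev, ?_, funext fun j => Fin.rev_rev _⟩
    have := key s
    omega
  · rintro ⟨t, ht, rfl⟩
    have := key t
    omega

end Count

variable (F : Type*) [Field F] {n : ℕ} (d : Fin n → ℕ)

theorem mem_monomialCIIdeal_iff (f : MvPolynomial (Fin n) F) :
    f ∈ monomialCIIdeal F d ↔ ∀ m ∈ f.support, ∃ i, d i + 1 ≤ m i := by
  have h : monomialCIIdeal F d = Ideal.span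
      ((fun m => monomial m (1 : F)) '' Set.range fun i => Finsupp.single i (d i + 1)) := by
    rw [monomialCIIdeal, ← Set.range_comp]
    congr 2
    funext i
    exact X_pow_eq_monomial
  rw [h, mem_ideal_span_monomial_image]
  simp only [Set.exists_range_iff, Finsupp.single_le_iff]

/-- The class of a monomial. -/
noncomputable def ciMonomial (s : CIExponent d) : MonomialCI F d :=
  Ideal.Quotient.mk (monomialCIIdeal F d) (monomial s.toFinsupp 1)

theorem mk_eq_smul_ciMonomial (s : CIExponent d) (a : F) :
    Ideal.Quotient.mk (monomialCIIdeal F d) (monomial s.toFinsupp a) = a • ciMonomial F d s := by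
  have : monomial s.toFinsupp a = a • monomial s.toFinsupp (1 : F) := by
    rw [smul_monomial, smul_eq_mul, mul_one]
  rw [this]
  rfl

theorem mk_monomial_eq_zero_or (m : Fin n →₀ ℕ) (a : F) :
    Ideal.Quotient.mk (monomialCIIdeal F d) (monomial m a) = 0 ∨
      ∃ s : CIExponent d, s.toFinsupp = m := by
  by_cases h : ∃ i, d i + 1 ≤ m i
  · left
    rw [Ideal.Quotient.eq_zero_iff_mem, mem_monomialCIIdeal_iff]
    intro m' hm'
    rw [Finset.mem_singleton.1 (support_monomial_subset hm')]
    exact h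
  · right
    push Not at h
    exact ⟨fun i => ⟨m i, h i⟩, Finsupp.ext fun i => rfl⟩

theorem ciMonomial_linearIndependent : LinearIndependent F (ciMonomial F d) := by
  classical
  rw [Fintype.linearIndependent_iff]
  intro c hc s
  have h1 : Ideal.Quotient.mk (monomialCIIdeal F d)
      (∑ t : CIExponent d, monomial t.toFinsupp (c t)) = 0 := by
    rw [map_sum, ← hc]
    exact Finset.sum_congr rfl fun t _ => mk_eq_smul_ciMonomial F d t (c t)
  rw [Ideal.Quotient.eq_zero_iff_mem, mem_monomialCIIdeal_iff] at h1
  by_contra hs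
  have h2 : coeff s.toFinsupp (∑ t : CIExponent d, monomial t.toFinsupp (c t)) = c s := by
    rw [coeff_sum, Finset.sum_eq_single s]
    · rw [coeff_monomial, if_pos rfl]
    · intro t _ hts
      rw [coeff_monomial, if_neg fun h => hts (CIExponent.toFinsupp_injective d h)]
    · simp
  obtain ⟨i, hi⟩ := h1 s.toFinsupp (by rw [MvPolynomial.mem_support_iff, h2]; exact hs)
  have h3 : s.toFinsupp i = (s i : ℕ) := rfl
  have := (s i).2
  omega

/-- The span of the monomials whose degree belongs to `T`. -/
noncomputable def degSpan (T : Set ℕ) : Submodule F (MonomialCI F d) :=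
  Submodule.span F (ciMonomial F d '' {s | s.deg ∈ T})

theorem ciMonomial_mem_degSpan {s : CIExponent d} {T : Set ℕ} (hs : s.deg ∈ T) :
    ciMonomial F d s ∈ degSpan F d T :=
  Submodule.subset_span ⟨s, hs, rfl⟩

theorem mk_monomial_mem_degSpan {m : Fin n →₀ ℕ} {T : Set ℕ} (hm : m.degree ∈ T) (a : F) :
    Ideal.Quotient.mk (monomialCIIdeal F d) (monomial m a) ∈ degSpan F d T := by
  rcases mk_monomial_eq_zero_or F d m a with h | ⟨s, rfl⟩
  · rw [h]; exact zero_mem _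
  · rw [mk_eq_smul_ciMonomial]
    rw [CIExponent.degree_toFinsupp] at hm
    exact Submodule.smul_mem _ _ (ciMonomial_mem_degSpan F d hm)

theorem degSpan_univ : degSpan F d Set.univ = ⊤ := by
  rw [eq_top_iff]
  rintro x -
  obtain ⟨f, rfl⟩ := Ideal.Quotient.mk_surjective x
  rw [f.as_sum, map_sum]
  exact Submodule.sum_mem _ fun m _ => mk_monomial_mem_degSpan F d (Set.mem_univ _) _

/-- The basis of monomials. -/
noncomputable def ciBasis : Basis (CIExponent d) F (MonomialCI F d) :=
  Basis.mk (ciMonomial_linearIndependent F d) (by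
    have h := degSpan_univ F d
    simp only [degSpan, Set.mem_univ, Set.ofPred_true, Set.image_univ] at h
    exact h.ge)

theorem ciBasis_apply (s : CIExponent d) : ciBasis F d s = ciMonomial F d s := by
  rw [ciBasis, Basis.mk_apply]

instance finiteDimensional_monomialCI : FiniteDimensional F (MonomialCI F d) :=
  (ciBasis F d).finiteDimensional_of_finite

theorem component_eq_degSpan (i : ℕ) : MonomialCI.component F d i = degSpan F d {i} := by
  apply le_antisymm
  · rintro x ⟨f, hf, rfl⟩
    have hf' : f.IsHomogeneous i := hf
    change Ideal.Quotient.mk (monomialCIIdeal F d) f ∈ _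
    rw [f.as_sum, map_sum]
    refine Submodule.sum_mem _ fun m hm => mk_monomial_mem_degSpan F d ?_ _
    rw [Set.mem_singleton_iff]
    by_contra h
    exact MvPolynomial.mem_support_iff.1 hm (hf'.coeff_eq_zero h)
  · refine Submodule.span_le.2 ?_
    rintro x ⟨s, hs, rfl⟩
    refine ⟨monomial s.toFinsupp 1, isHomogeneous_monomial _ ?_, rfl⟩
    rw [CIExponent.degree_toFinsupp]
    exact hs

theorem finrank_degSpan (T : Set ℕ) : finrank F (degSpan F d T) = degCount d T := by
  classical
  rw [degSpan, Set.image_eq_range, finrank_span_eq_card, degCount, ← Nat.card_coe_set_eq,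
    Nat.card_eq_fintype_card]
  exact (ciMonomial_linearIndependent F d).comp _ Subtype.val_injective

theorem degSpan_mono {T T' : Set ℕ} (h : T ⊆ T') : degSpan F d T ≤ degSpan F d T' :=
  Submodule.span_mono (Set.image_mono fun _ hs => h hs)

theorem degSpan_union (T T' : Set ℕ) :
    degSpan F d (T ∪ T') = degSpan F d T ⊔ degSpan F d T' := by
  rw [degSpan, degSpan, degSpan, ← Submodule.span_union, ← Set.image_union]
  rfl

theorem disjoint_degSpan {T T' : Set ℕ} (h : Disjoint T T') :
    Disjoint (degSpan F d T) (degSpan F d T') :=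
  (ciMonomial_linearIndependent F d).disjoint_span_image
    (Set.disjoint_left.2 fun _ hs hs' => Set.disjoint_left.1 h hs hs')

open scoped Pointwise in
theorem mul_mem_degSpan {T T' : Set ℕ} {x y : MonomialCI F d} (hx : x ∈ degSpan F d T)
    (hy : y ∈ degSpan F d T') : x * y ∈ degSpan F d (T + T') := by
  have h := Submodule.mul_mem_mul hx hy
  rw [degSpan, degSpan, Submodule.span_mul_span] at h
  refine Submodule.span_le.2 ?_ h
  rintro _ ⟨_, ⟨s, hs, rfl⟩, _, ⟨t, ht, rfl⟩, rfl⟩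
  change ciMonomial F d s * ciMonomial F d t ∈ degSpan F d (T + T')
  rw [ciMonomial, ciMonomial, ← map_mul, monomial_mul]
  refine mk_monomial_mem_degSpan F d ?_ _
  rw [map_add, CIExponent.degree_toFinsupp, CIExponent.degree_toFinsupp]
  exact Set.add_mem_add hs ht

theorem one_mem_degSpan : (1 : MonomialCI F d) ∈ degSpan F d {0} := by
  have := mk_monomial_mem_degSpan F d (m := 0) (T := {0}) (by simp) 1
  exact this

theorem pow_mul_mem_degSpan_Ici {m : MonomialCI F d} (hm : m ∈ degSpan F d (Set.Ici 1)) (k j : ℕ)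
    {y : MonomialCI F d} (hy : y ∈ degSpan F d (Set.Ici j)) :
    m ^ k * y ∈ degSpan F d (Set.Ici (j + k)) := by
  induction k with
  | zero => simpa using hy
  | succ k ih =>
    rw [pow_succ', mul_assoc]
    refine degSpan_mono F d ?_ (mul_mem_degSpan F d hm ih)
    rintro _ ⟨a, ha, b, hb, rfl⟩
    simp only [Set.mem_Ici] at *
    omega

theorem pow_mul_mem_degSpan {m : MonomialCI F d} (hm : m ∈ degSpan F d {1}) (k : ℕ) {T T' : Set ℕ}
    (hT : ∀ i ∈ T, i + k ∈ T') {y : MonomialCI F d} (hy : y ∈ degSpan F d T) :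
    m ^ k * y ∈ degSpan F d T' := by
  induction k generalizing T y with
  | zero => simpa using degSpan_mono F d hT hy
  | succ k ih =>
    rw [pow_succ, mul_assoc]
    refine ih ?_ (mul_mem_degSpan F d hm hy)
    rintro _ ⟨a, ha, b, hb, rfl⟩
    rw [Set.mem_singleton_iff] at ha
    subst ha
    have := hT b hb
    rwa [show b + (k + 1) = 1 + b + k by omega] at this

/-! ### Ranks of powers: the general bound and its attainment -/

/-- Split the source at degree `j`: the low part contributes at most its dimension, the high part is
pushed into degree ≥ `j + k`. The cut `j` is free, so it can be chosen to suit `k`. -/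
theorem finrank_range_mulLeft_pow_le {m : MonomialCI F d} (hm : m ∈ degSpan F d (Set.Ici 1))
    (k j : ℕ) : finrank F (LinearMap.range (LinearMap.mulLeft F (m ^ k))) ≤
      degCount d (Set.Iio j) + degCount d (Set.Ici (j + k)) := by
  have h1 : (⊤ : Submodule F (MonomialCI F d)) =
      degSpan F d (Set.Iio j) ⊔ degSpan F d (Set.Ici j) := by
    rw [← degSpan_union, Set.Iio_union_Ici, degSpan_univ]
  rw [LinearMap.range_eq_map, h1, Submodule.map_sup]
  refine (Submodule.finrank_add_le_finrank_add_finrank _ _).trans (add_le_add ?_ ?_)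
  · rw [← finrank_degSpan F d]
    exact Submodule.finrank_map_le _ _
  · rw [← finrank_degSpan F d]
    refine Submodule.finrank_mono ?_
    rintro _ ⟨y, hy, rfl⟩
    exact pow_mul_mem_degSpan_Ici F d hm k j hy

theorem sum_x_mem_degSpan : ∑ i, MonomialCI.x F d i ∈ degSpan F d {1} :=
  Submodule.sum_mem _ fun i _ => mk_monomial_mem_degSpan F d (by simp) 1

theorem eq_zero_of_sum_x_pow_mul_eq_zero (p : ℕ) [CharP F p] (hp : p = 0 ∨ ∑ i, d i < p)
    {i k : ℕ} (hik : 2 * i + k ≤ ∑ j, d j) {y : MonomialCI F d} (hy : y ∈ degSpan F d {i})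
    (h : (∑ j, MonomialCI.x F d j) ^ k * y = 0) : y = 0 := by
  rw [← component_eq_degSpan] at hy
  obtain ⟨f, hf, rfl⟩ := hy
  have h1 : Ideal.Quotient.mk (monomialCIIdeal F d) ((∑ j, X j) ^ k * f) = 0 := by
    rw [map_mul, map_pow, map_sum]
    exact h
  exact Ideal.Quotient.eq_zero_iff_mem.2 (mem_monomialCIIdeal_of_sum_X_pow_mul_mem p d hp i k f hf
    hik (Ideal.Quotient.eq_zero_iff_mem.1 h1))

/-- Multiplication by L^k is homogeneous, so the top component of `y` can be split off and killed by
itself. -/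
theorem eq_zero_of_mem_degSpan_Iio (p : ℕ) [CharP F p] (hp : p = 0 ∨ ∑ i, d i < p)
    {j k : ℕ} (hjk : ∀ i < j, 2 * i + k ≤ ∑ j, d j) {y : MonomialCI F d}
    (hy : y ∈ degSpan F d (Set.Iio j)) (h : (∑ j, MonomialCI.x F d j) ^ k * y = 0) : y = 0 := by
  induction j generalizing y with
  | zero =>
    have : degSpan F d (Set.Iio 0) = ⊥ := by simp [degSpan]
    rw [this] at hy
    exact (Submodule.mem_bot F).1 hy
  | succ j ih =>
    have hset : Set.Iio (j + 1) = Set.Iio j ∪ {j} := by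
      ext i
      simp only [Set.mem_Iio, Set.mem_union, Set.mem_singleton_iff]
      omega
    rw [hset, degSpan_union] at hy
    obtain ⟨a, ha, c, hc, rfl⟩ := Submodule.mem_sup.1 hy
    have ha' : (∑ j, MonomialCI.x F d j) ^ k * a ∈ degSpan F d (Set.Iio (j + k)) :=
      pow_mul_mem_degSpan F d (sum_x_mem_degSpan F d) k
        (fun i hi => by simp only [Set.mem_Iio] at *; omega) ha
    have hc' : (∑ j, MonomialCI.x F d j) ^ k * c ∈ degSpan F d {j + k} :=
      pow_mul_mem_degSpan F d (sum_x_mem_degSpan F d) k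
        (fun i hi => by simp only [Set.mem_singleton_iff] at *; omega) hc
    rw [mul_add] at h
    have hdisj := disjoint_degSpan F d (T := Set.Iio (j + k)) (T' := {j + k}) (by simp)
    have hc0 : (∑ j, MonomialCI.x F d j) ^ k * c = 0 := by
      refine Submodule.disjoint_def.1 hdisj _ ?_ hc'
      rw [eq_neg_of_add_eq_zero_right h]
      exact neg_mem ha'
    rw [hc0, add_zero] at h
    rw [ih (fun i hi => hjk i (by omega)) ha h,
      eq_zero_of_sum_x_pow_mul_eq_zero F d p hp (hjk j (by omega)) hc hc0, add_zero]

theorem degSpan_le_range_sum_x_pow (p : ℕ) [CharP F p] (hp : p = 0 ∨ ∑ i, d i < p) {t k : ℕ}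
    (ht : ∑ j, d j + k ≤ 2 * t) : degSpan F d {t} ≤
      LinearMap.range (LinearMap.mulLeft F ((∑ j, MonomialCI.x F d j) ^ k)) := by
  set N := ∑ j, d j with hN
  -- Above degree N the component is zero; below, `N - t` is a genuine difference.
  by_cases htN : N < t
  · have : degSpan F d {t} = ⊥ := by
      rw [← Submodule.finrank_eq_zero (R := F), finrank_degSpan,
        degCount_congr d (T := {t}) (T' := ∅) (fun i hi => by
          simp only [Set.mem_singleton_iff, Set.mem_empty_iff_false, iff_false]; omega)]
      simp [degCount]
    rw [this]
    exact bot_le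
  -- L^q maps B_(N−t) injectively into B_t, a space of the same dimension, hence onto it. Since q ≥
  -- k, this map factors through L^k.
  set q := 2 * t - N with hq
  have hmap : (degSpan F d {N - t}).map
      (LinearMap.mulLeft F ((∑ j, MonomialCI.x F d j) ^ q)) = degSpan F d {t} := by
    refine Submodule.eq_of_le_of_finrank_eq ?_ ?_
    · rintro _ ⟨y, hy, rfl⟩
      exact pow_mul_mem_degSpan F d (sum_x_mem_degSpan F d) q
        (fun i hi => by simp only [Set.mem_singleton_iff] at *; omega) hy
    · rw [finrank_degSpan, ← degCount_reverse d (i := t) (by omega), ← finrank_degSpan F d]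
      refine LinearEquiv.finrank_eq (LinearEquiv.ofBijective
        ((LinearMap.mulLeft F ((∑ j, MonomialCI.x F d j) ^ q)).submoduleMap
          (degSpan F d {N - t})) ⟨?_, LinearMap.submoduleMap_surjective _ _⟩).symm
      rw [injective_iff_map_eq_zero]
      rintro ⟨y, hy⟩ h
      have h' : (∑ j, MonomialCI.x F d j) ^ q * y = 0 := congrArg Subtype.val h
      exact Subtype.ext (eq_zero_of_sum_x_pow_mul_eq_zero F d p hp (by omega) hy h')
  rw [← hmap]
  rintro _ ⟨y, -, rfl⟩
  refine ⟨(∑ j, MonomialCI.x F d j) ^ (q - k) * y, ?_⟩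
  rw [LinearMap.mulLeft_apply, LinearMap.mulLeft_apply, ← mul_assoc, ← pow_add]
  congr 2
  omega

/-- Degrees below `j` map injectively into degrees below `j + k`, and all degrees from `j + k` on
lie in the image. These two subspaces of the image are disjoint, so their dimensions add up. -/
theorem le_finrank_range_sum_x_pow (p : ℕ) [CharP F p] (hp : p = 0 ∨ ∑ i, d i < p) {j k : ℕ}
    (hjk : ∀ i < j, 2 * i + k ≤ ∑ j, d j) (hjk' : ∑ j, d j ≤ 2 * j + k) :
    degCount d (Set.Iio j) + degCount d (Set.Ici (j + k)) ≤
      finrank F (LinearMap.range (LinearMap.mulLeft F ((∑ j, MonomialCI.x F d j) ^ k))) := by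
  set g := LinearMap.mulLeft F ((∑ j, MonomialCI.x F d j) ^ k) with hg
  have h1 : finrank F ((degSpan F d (Set.Iio j)).map g) = degCount d (Set.Iio j) := by
    rw [← finrank_degSpan F d]
    refine LinearEquiv.finrank_eq (LinearEquiv.ofBijective
      (g.submoduleMap (degSpan F d (Set.Iio j))) ⟨?_, LinearMap.submoduleMap_surjective _ _⟩).symm
    rw [injective_iff_map_eq_zero]
    rintro ⟨y, hy⟩ h
    exact Subtype.ext (eq_zero_of_mem_degSpan_Iio F d p hp hjk hy (congrArg Subtype.val h))
  have h2 : (degSpan F d (Set.Iio j)).map g ≤ degSpan F d (Set.Iio (j + k)) := by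
    rintro _ ⟨y, hy, rfl⟩
    exact pow_mul_mem_degSpan F d (sum_x_mem_degSpan F d) k
      (fun i hi => by simp only [Set.mem_Iio] at *; omega) hy
  have h3 : Disjoint ((degSpan F d (Set.Iio j)).map g) (degSpan F d (Set.Ici (j + k))) :=
    (disjoint_degSpan F d (Set.Iio_disjoint_Ici le_rfl)).mono_left h2
  have h4 : degSpan F d (Set.Ici (j + k)) ≤ LinearMap.range g := by
    refine Submodule.span_le.2 ?_
    rintro _ ⟨s, hs, rfl⟩
    refine degSpan_le_range_sum_x_pow F d p hp (t := s.deg) ?_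
      (ciMonomial_mem_degSpan F d rfl)
    have : j + k ≤ s.deg := hs
    omega
  have h5 := Submodule.finrank_sup_add_finrank_inf_eq ((degSpan F d (Set.Iio j)).map g)
    (degSpan F d (Set.Ici (j + k)))
  rw [h3.eq_bot, finrank_bot, add_zero, h1, finrank_degSpan] at h5
  rw [← h5]
  exact Submodule.finrank_mono (sup_le (LinearMap.map_le_range) h4)

instance nontrivial_monomialCI : Nontrivial (MonomialCI F d) :=
  (ciBasis F d).repr.toEquiv.nontrivial

/-- The element L^i · 1 of B_i is nonzero by the Lefschetz property in degree 0. This makes the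
parts of the Weyr structure positive. -/
theorem degCount_pos (p : ℕ) [CharP F p] (hp : p = 0 ∨ ∑ i, d i < p) {i : ℕ}
    (hi : i ≤ ∑ j, d j) : 1 ≤ degCount d {i} := by
  by_contra h
  have h0 : degSpan F d {i} = ⊥ := by
    rw [← Submodule.finrank_eq_zero (R := F), finrank_degSpan]
    omega
  have h1 : (∑ j, MonomialCI.x F d j) ^ i * 1 ∈ degSpan F d {i} :=
    pow_mul_mem_degSpan F d (sum_x_mem_degSpan F d) i
      (fun a ha => by simp only [Set.mem_singleton_iff] at *; omega) (one_mem_degSpan F d)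
  rw [h0, Submodule.mem_bot] at h1
  exact one_ne_zero (eq_zero_of_sum_x_pow_mul_eq_zero F d p hp (by omega)
    (one_mem_degSpan F d) h1)

end MonomialBasis

/-! ### Minors as polynomial functions -/

section ZariskiOpen

variable {F V W : Type*} [Field F] [AddCommGroup V] [Module F V] [AddCommGroup W] [Module F W]

/-- A minor of size `r` which does not vanish shows that the rank is at least `r`. -/
theorem le_finrank_range_of_det_ne_zero [FiniteDimensional F W] {r : ℕ} (g : V →ₗ[F] W)
    (y : Fin r → V) (φ : Fin r → Dual F W)
    (h : (Matrix.of fun a b => φ a (g (y b))).det ≠ 0) : r ≤ finrank F (LinearMap.range g) := by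
  have hli : LinearIndependent F fun b => (⟨g (y b), y b, rfl⟩ : LinearMap.range g) := by
    rw [Fintype.linearIndependent_iff]
    intro c hc
    have h1 : ∑ b, c b • g (y b) = 0 := by
      have := congrArg (fun z : LinearMap.range g => (z : W)) hc
      simpa using this
    have h2 : (Matrix.of fun a b => φ a (g (y b))).mulVec c = 0 := by
      funext a
      have := congrArg (φ a) h1
      rw [map_sum, map_zero] at this
      rw [Pi.zero_apply, ← this, Matrix.mulVec_eq_sum, Finset.sum_apply]
      refine Finset.sum_congr rfl fun b _ => ?_
      rw [map_smul, Pi.smul_apply, op_smul_eq_smul]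
      rfl
    exact congrFun (Matrix.eq_zero_of_mulVec_eq_zero h h2)
  simpa using hli.fintype_card_le_finrank

/-- Take `r` independent vectors of the image, preimages `y` of them, and functionals dual to them:
the matrix is then the identity. -/
theorem exists_det_ne_zero [FiniteDimensional F W] {r : ℕ} (g : V →ₗ[F] W)
    (h : r ≤ finrank F (LinearMap.range g)) :
    ∃ (y : Fin r → V) (φ : Fin r → Dual F W),
      (Matrix.of fun a b => φ a (g (y b))).det ≠ 0 := by
  set e := finBasis F (LinearMap.range g) with he
  have hw : LinearIndependent F fun a : Fin r => (e (Fin.castLE h a) : W) :=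
    (e.linearIndependent.map' (LinearMap.range g).subtype (Submodule.ker_subtype _)).comp _
      (Fin.castLE_injective h)
  obtain ⟨q, hq⟩ := LinearMap.exists_leftInverse_of_injective
    (Fintype.linearCombination F fun a : Fin r => (e (Fin.castLE h a) : W))
    (LinearMap.ker_eq_bot.2 (linearIndependent_iff_injective_fintypeLinearCombination.1 hw))
  choose y hy using fun a : Fin r => (e (Fin.castLE h a)).2
  refine ⟨y, fun a => (LinearMap.proj a).comp q, ?_⟩
  have h1 : (Matrix.of fun a b => ((LinearMap.proj a).comp q : Dual F W) (g (y b))) = 1 := by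
    ext a b
    have h2 := LinearMap.congr_fun hq (Pi.single b 1)
    rw [LinearMap.comp_apply, Fintype.linearCombination_apply_single, one_smul] at h2
    rw [Matrix.of_apply, LinearMap.comp_apply, hy, h2, Matrix.one_apply]
    simp [Pi.single_apply]
  rw [h1, Matrix.det_one]
  exact one_ne_zero

theorem det_mem_polynomialFunctionsOn {r : ℕ} (M : Fin r → Fin r → V → F)
    (hM : ∀ a b, M a b ∈ polynomialFunctionsOn F V) :
    (fun v => (Matrix.of fun a b => M a b v).det) ∈ polynomialFunctionsOn F V := by
  have : (fun v => (Matrix.of fun a b => M a b v).det) =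
      ∑ σ : Equiv.Perm (Fin r), ((Equiv.Perm.sign σ : ℤ) : F) • ∏ a, M (σ a) a := by
    funext v
    rw [Matrix.det_apply', Finset.sum_apply]
    simp [Finset.prod_apply]
  rw [this]
  exact Subalgebra.sum_mem _ fun σ _ => Subalgebra.smul_mem _
    (Subalgebra.prod_mem _ fun a _ => hM _ _) _

theorem dual_mem_polynomialFunctionsOn (φ : Dual F V) :
    (φ : V → F) ∈ polynomialFunctionsOn F V :=
  Algebra.subset_adjoin ⟨φ, rfl⟩

theorem pow_mul_mem_polynomialFunctionsOn {A : Type*} [CommRing A] [Algebra F A]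
    [FiniteDimensional F A] (m : V →ₗ[F] A) (k : ℕ) (φ : Dual F A) (y : A) :
    (fun v => φ (m v ^ k * y)) ∈ polynomialFunctionsOn F V := by
  induction k generalizing y with
  | zero =>
    have : (fun v : V => φ (m v ^ 0 * y)) = algebraMap F (V → F) (φ y) := by
      funext v
      simp
    rw [this]
    exact Subalgebra.algebraMap_mem _ _
  | succ k ih =>
    set b := finBasis F A with hb
    -- Expand `m v * y` in a basis of `A`: its coordinates are linear in `v`, and the remaining
    -- factor `m v ^ k` falls under the induction hypothesis for each basis vector.
    have : (fun v => φ (m v ^ (k + 1) * y)) =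
        ∑ i, (((b.coord i).comp (LinearMap.mulRight F y)).comp m : V → F) *
          fun v => φ (m v ^ k * b i) := by
      funext v
      rw [Finset.sum_apply, pow_succ, mul_assoc]
      conv_lhs => rw [← b.sum_repr (m v * y)]
      rw [Finset.mul_sum, map_sum]
      refine Finset.sum_congr rfl fun i _ => ?_
      rw [mul_smul_comm, map_smul]
      rfl
    rw [this]
    exact Subalgebra.sum_mem _ fun i _ =>
      Subalgebra.mul_mem _ (dual_mem_polynomialFunctionsOn _) (ih _)

end ZariskiOpen

/-! ### Sorting through increments over central windows -/

section Sorting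

theorem List.sort_eq_map_range {L : Multiset ℕ} {δ : ℕ → ℕ} (hδ : Antitone δ) (K : ℕ)
    (h : L = (Multiset.range K).map δ) : L.sort (· ≥ ·) = (List.range K).map δ := by
  have h1 : L = (((List.range K).map δ : List ℕ) : Multiset ℕ) := by
    rw [h]
    rfl
  rw [h1]
  refine List.Perm.eq_of_pairwise (le := (· ≥ ·)) (fun a b _ _ h h' => le_antisymm h' h)
    (Multiset.pairwise_sort _ _) ?_ ?_
  · rw [List.pairwise_map]
    exact List.pairwise_lt_range.imp fun h => hδ h.le
  · rw [← Multiset.coe_eq_coe, Multiset.sort_eq]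

/-- The values of `h` on `{0, …, N}` are the increments of its sums over the central windows. -/
theorem map_range_eq_map_increments (h κ δ : ℕ → ℕ) (N : ℕ)
    (hκ : ∀ k ≤ N + 1, κ k = ∑ i ∈ Finset.Ico ((N + 2 - k) / 2) ((N + 2 - k) / 2 + k), h i)
    (hδ : ∀ k ≤ N, κ (k + 1) = κ k + δ k) :
    (Multiset.range (N + 1)).map h = (Multiset.range (N + 1)).map δ := by
  have key : ∀ k ≤ N + 1,
      (Finset.Ico ((N + 2 - k) / 2) ((N + 2 - k) / 2 + k)).val.map h =
        (Multiset.range k).map δ := by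
    intro k
    induction k with
    | zero => intro _; simp
    | succ k ih =>
      intro hk
      have h1 := hκ k (by omega)
      have h2 := hκ (k + 1) hk
      have h3 := hδ k (by omega)
      -- According to the parity of N − k, the window either keeps its left end and gains a degree
      -- on the right, or moves its left end down by one and keeps its right end.
      obtain ⟨e, he, hI⟩ : ∃ e, e ∉ Finset.Ico ((N + 2 - k) / 2) ((N + 2 - k) / 2 + k) ∧
          Finset.Ico ((N + 2 - (k + 1)) / 2) ((N + 2 - (k + 1)) / 2 + (k + 1)) =
            insert e (Finset.Ico ((N + 2 - k) / 2) ((N + 2 - k) / 2 + k)) := by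
        by_cases hj : (N + 2 - (k + 1)) / 2 = (N + 2 - k) / 2
        · refine ⟨(N + 2 - k) / 2 + k, by simp, ?_⟩
          ext i
          simp only [Finset.mem_insert, Finset.mem_Ico]
          omega
        · refine ⟨(N + 2 - (k + 1)) / 2, by rw [Finset.mem_Ico]; omega, ?_⟩
          ext i
          simp only [Finset.mem_insert, Finset.mem_Ico]
          omega
      rw [hI, Finset.sum_insert he] at h2
      rw [hI, Finset.insert_val_of_notMem he, Multiset.map_cons, ih (by omega),
        Multiset.range_succ, Multiset.map_cons]
      congr 1
      omega
  have h0 := key (N + 1) le_rfl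
  have h1 : (N + 2 - (N + 1)) / 2 = 0 := by omega
  rw [h1, zero_add, ← Finset.range_eq_Ico] at h0
  exact h0

end Sorting

/-! ### Weyr structure of an element of maximal ranks -/

section GeneralElement

variable (F : Type*) [Field F] {n : ℕ} (d : Fin n → ℕ)

/-- The constant term. -/
noncomputable def constTerm : Dual F (MonomialCI F d) := (ciBasis F d).coord fun _ => 0

/-- An element minus its constant term. -/
noncomputable def nilpotentPart : MonomialCI F d →ₗ[F] MonomialCI F d :=
  LinearMap.id - (constTerm F d).smulRight 1

theorem ciMonomial_zero : ciMonomial F d (fun _ => 0) = 1 := by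
  have : CIExponent.toFinsupp (fun _ => 0 : CIExponent d) = 0 := Finsupp.ext fun i => rfl
  rw [ciMonomial, this]
  rfl

theorem CIExponent.deg_eq_zero {s : CIExponent d} (hs : s.deg = 0) : s = fun _ => 0 := by
  funext i
  exact Fin.ext (Finset.sum_eq_zero_iff.1 hs i (Finset.mem_univ i))

theorem nilpotentPart_mem (l : MonomialCI F d) :
    nilpotentPart F d l ∈ degSpan F d (Set.Ici 1) := by
  classical
  have h1 : ∀ s, nilpotentPart F d (ciBasis F d s) ∈ degSpan F d (Set.Ici 1) := by
    intro s
    by_cases hs : s = fun _ => 0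
    · subst hs
      have : nilpotentPart F d (ciBasis F d fun _ => 0) = 0 := by
        simp [nilpotentPart, constTerm, ciBasis_apply, ciMonomial_zero]
        rw [← ciMonomial_zero, ← ciBasis_apply, Basis.repr_self]
        simp
      rw [this]
      exact zero_mem _
    · have : nilpotentPart F d (ciBasis F d s) = ciMonomial F d s := by
        rw [nilpotentPart, LinearMap.sub_apply, LinearMap.smulRight_apply, constTerm,
          Basis.coord_apply, Basis.repr_self, Finsupp.single_eq_of_ne (Ne.symm hs), zero_smul,
          sub_zero, LinearMap.id_apply, ciBasis_apply]
      rw [this]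
      refine ciMonomial_mem_degSpan F d ?_
      rw [Set.mem_Ici, Nat.one_le_iff_ne_zero]
      exact fun h => hs (CIExponent.deg_eq_zero d h)
  rw [← (ciBasis F d).sum_repr l, map_sum]
  exact Submodule.sum_mem _ fun s _ => by
    rw [map_smul]; exact Submodule.smul_mem _ _ (h1 s)

theorem nilpotentPart_add (l : MonomialCI F d) :
    nilpotentPart F d l + constTerm F d l • 1 = l := by
  simp [nilpotentPart]

theorem nilpotentPart_eq_self {l : MonomialCI F d} (hl : l ∈ degSpan F d (Set.Ici 1)) :
    nilpotentPart F d l = l := by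
  have h1 : l - nilpotentPart F d l ∈ degSpan F d {0} := by
    have h := nilpotentPart_add F d l
    rw [sub_eq_of_eq_add' h.symm]
    exact Submodule.smul_mem _ _ (one_mem_degSpan F d)
  have h2 := Submodule.sub_mem _ hl (nilpotentPart_mem F d l)
  have h3 := disjoint_degSpan F d (T := {0}) (T' := Set.Ici 1) (by simp)
  exact (sub_eq_zero.1 (Submodule.disjoint_def.1 h3 _ h1 h2)).symm

theorem finrank_monomialCI : finrank F (MonomialCI F d) = degCount d Set.univ := by
  rw [← finrank_degSpan F d, degSpan_univ, finrank_top]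

theorem finrank_component (i : ℕ) : finrank F (MonomialCI.component F d i) = degCount d {i} := by
  rw [component_eq_degSpan, finrank_degSpan]

theorem finrank_monomialCI_eq_sum : finrank F (MonomialCI F d) =
    ∑ i ∈ Finset.range ((∑ j, d j) + 1), finrank F (MonomialCI.component F d i) := by
  rw [finrank_monomialCI, degCount_congr d (T := Set.univ)
    (T' := (Finset.range ((∑ j, d j) + 1) : Finset ℕ)) (fun i hi => by simp; omega),
    degCount_finset]
  simp only [finrank_component]

/-- The opposite inequality always holds, so the hypothesis fixes every rank, and thereby the kernel
dimensions as sums over central windows. -/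
theorem hasWeyrStructure_of_rank_le (p : ℕ) [CharP F p] (hp : p = 0 ∨ ∑ i, d i < p)
    (l : MonomialCI F d)
    (hl : ∀ k < (∑ j, d j) + 2, degCount d (Set.Iio (((∑ j, d j) + 2 - k) / 2)) +
      degCount d (Set.Ici (((∑ j, d j) + 2 - k) / 2 + k)) ≤
        finrank F (LinearMap.range (LinearMap.mulLeft F (nilpotentPart F d l ^ k)))) :
    HasWeyrStructure (LinearMap.mulLeft F l) (MonomialCI.sortedDims F d) := by
  set N := ∑ j, d j with hN
  set m := nilpotentPart F d l with hm
  set g : Module.End F (MonomialCI F d) := LinearMap.mulLeft F m with hg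
  have hgk : ∀ k, g ^ k = LinearMap.mulLeft F (m ^ k) := fun k => LinearMap.pow_mulLeft F _ m k
  set δ : ℕ → ℕ := fun i =>
    finrank F (LinearMap.ker g ⊓ LinearMap.range (g ^ i) : Submodule F (MonomialCI F d)) with hδ
  have hκ : ∀ k ≤ N + 1, finrank F (LinearMap.ker (g ^ k)) =
      ∑ i ∈ Finset.Ico ((N + 2 - k) / 2) ((N + 2 - k) / 2 + k), degCount d {i} := by
    intro k hk
    have h1 := LinearMap.finrank_range_add_finrank_ker (g ^ k)
    have h2 : finrank F (LinearMap.range (g ^ k)) =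
        degCount d (Set.Iio ((N + 2 - k) / 2)) + degCount d (Set.Ici ((N + 2 - k) / 2 + k)) := by
      rw [hgk]
      exact le_antisymm (finrank_range_mulLeft_pow_le F d (nilpotentPart_mem F d l) k _)
        (hl k (by omega))
    rw [← degCount_finset, Finset.coe_Ico]
    set j := (N + 2 - k) / 2
    have h3 : degCount d Set.univ = degCount d (Set.Iio j) + degCount d (Set.Ico j (j + k)) +
        degCount d (Set.Ici (j + k)) := by
      rw [← degCount_union, ← degCount_union]
      · congr 1
        ext i
        simp only [Set.mem_univ, Set.mem_union, Set.mem_Iio, Set.mem_Ico, Set.mem_Ici, true_iff]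
        omega
      · rw [Set.disjoint_left]
        intro i
        simp only [Set.mem_union, Set.mem_Iio, Set.mem_Ico, Set.mem_Ici]
        omega
      · rw [Set.disjoint_left]
        intro i
        simp only [Set.mem_Iio, Set.mem_Ico]
        omega
    rw [h2, finrank_monomialCI, h3] at h1
    omega
  have hms := map_range_eq_map_increments (fun i => degCount d {i})
    (fun k => finrank F (LinearMap.ker (g ^ k))) δ N hκ fun k _ => finrank_ker_pow_succ g k
  -- `δ` permutes the component dimensions and is antitone, so listing its values is already the
  -- sorted list.
  have hL : MonomialCI.sortedDims F d = (List.range (N + 1)).map δ := by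
    refine List.sort_eq_map_range (finrank_ker_inf_range_pow_antitone g) _ ?_
    rw [← hms]
    simp only [finrank_component]
    rfl
  have hnil : g ^ (N + 1) = 0 := by
    refine LinearMap.ext fun y => ?_
    have hy : y ∈ degSpan F d (Set.Ici 0) := by
      rw [show Set.Ici 0 = (Set.univ : Set ℕ) by ext; simp, degSpan_univ]
      exact Submodule.mem_top
    have h1 := pow_mul_mem_degSpan_Ici F d (nilpotentPart_mem F d l) (N + 1) 0 hy
    have h2 : degSpan F d (Set.Ici (0 + (N + 1))) = ⊥ := by
      rw [← Submodule.finrank_eq_zero (R := F), finrank_degSpan,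
        degCount_congr d (T := Set.Ici (0 + (N + 1))) (T' := ∅) (fun i hi => by
          simp only [Set.mem_Ici, Set.mem_empty_iff_false, iff_false]; omega)]
      simp [degCount]
    rw [h2, Submodule.mem_bot] at h1
    rw [hgk]
    exact h1
  have hT : LinearMap.mulLeft F l = g + constTerm F d l • 1 := by
    refine LinearMap.ext fun y => ?_
    conv_lhs => rw [← nilpotentPart_add F d l]
    simp [hg, hm, add_mul]
  rw [hT]
  refine hasWeyrStructure_add_smul g _ ?_ ?_ ⟨?_, ?_, ?_⟩ _
  · intro i
    have : (MonomialCI.sortedDims F d).get i = δ i := by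
      simp only [hL, List.get_eq_getElem, List.getElem_map, List.getElem_range]
    exact this
  · rw [hL, List.length_map, List.length_range, hnil]
  · simp [hL]
  · exact Multiset.pairwise_sort _ _
  · intro a ha
    rw [MonomialCI.sortedDims, Multiset.mem_sort, Multiset.mem_map] at ha
    obtain ⟨i, hi, rfl⟩ := ha
    rw [finrank_component]
    exact degCount_pos F d p hp (Nat.lt_succ_iff.1 (Multiset.mem_range.1 hi))

end GeneralElement

theorem mainTheorem2 (F : Type*) [Field F] (p : ℕ) [CharP F p] (n : ℕ) (d : Fin n → ℕ)
    (hp : p = 0 ∨ ∑ i, d i < p) :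
    finrank F (MonomialCI F d) =
        ∑ i ∈ Finset.range ((∑ j, d j) + 1), finrank F (MonomialCI.component F d i) ∧
    ∃ U : Set (MonomialCI F d), IsZariskiOpen F U ∧ (∑ i, MonomialCI.x F d i) ∈ U ∧
      ∀ l ∈ U, HasWeyrStructure (LinearMap.mulLeft F l) (MonomialCI.sortedDims F d) := by
  refine ⟨finrank_monomialCI_eq_sum F d, ?_⟩
  set N := ∑ j, d j with hN
  -- For k ≤ N + 1 the cut j = ⌊(N+2−k)/2⌋ satisfies N + 1 ≤ 2j + k ≤ N + 2. So i < j gives 2i + k ≤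
  -- N, and t ≥ j + k gives 2t ≥ N + k: both halves of the Lefschetz property apply.
  set ρ : ℕ → ℕ := fun k => degCount d (Set.Iio ((N + 2 - k) / 2)) +
      degCount d (Set.Ici ((N + 2 - k) / 2 + k)) with hρ
  have hx : nilpotentPart F d (∑ i, MonomialCI.x F d i) = ∑ i, MonomialCI.x F d i :=
    nilpotentPart_eq_self F d (degSpan_mono F d (by simp) (sum_x_mem_degSpan F d))
  -- Rows and columns of a minor of size `ρ k` are fixed by its not vanishing at L; for k ≥ N + 2
  -- the choice is arbitrary.
  have hex : ∀ k, ∃ (y : Fin (ρ k) → MonomialCI F d)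
      (φ : Fin (ρ k) → Dual F (MonomialCI F d)), k < N + 2 →
      (Matrix.of fun a b => φ a (LinearMap.mulLeft F ((∑ i, MonomialCI.x F d i) ^ k) (y b))).det
        ≠ 0 := by
    intro k
    by_cases hk : k < N + 2
    · obtain ⟨y, φ, h⟩ := exists_det_ne_zero _ (le_finrank_range_sum_x_pow F d p hp
        (j := (N + 2 - k) / 2) (k := k) (fun i hi => by omega) (by omega))
      exact ⟨y, φ, fun _ => h⟩
    · exact ⟨fun _ => 0, fun _ => 0, fun h => absurd h hk⟩
  choose y φ hφ using hex
  set f : ℕ → MonomialCI F d → F := fun k l =>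
    (Matrix.of fun a b => φ k a (nilpotentPart F d l ^ k * y k b)).det with hf
  -- Only the powers k ≤ N + 1 matter, so U is the locus where one polynomial function, the product
  -- of these finitely many minors, is nonzero.
  refine ⟨{l | ∃ f' ∈ ({∏ k ∈ Finset.range (N + 2), f k} : Set (MonomialCI F d → F)), f' l ≠ 0},
    ⟨_, ?_, rfl⟩, ⟨_, rfl, ?_⟩, ?_⟩
  · rintro _ rfl
    exact Subalgebra.prod_mem _ fun k _ => det_mem_polynomialFunctionsOn _ fun a b =>
      pow_mul_mem_polynomialFunctionsOn _ _ _ _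
  · rw [Finset.prod_apply, Finset.prod_ne_zero_iff]
    intro k hk
    simp only [hf, hx]
    exact hφ k (Finset.mem_range.1 hk)
  · rintro l ⟨_, rfl, hl⟩
    rw [Finset.prod_apply, Finset.prod_ne_zero_iff] at hl
    refine hasWeyrStructure_of_rank_le F d p hp l fun k hk => ?_
    exact le_finrank_range_of_det_ne_zero _ (y k) (φ k) (hl k (Finset.mem_range.2 hk))
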